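/- Let $d \ge 1$ be an integer and, for $M \in L(\mathbb{C}^d)$ (the linear operators on $\mathbb{C}^d$), let $\|M\|_{\mathrm{tr}} = \mathrm{Tr}\sqrt{M^\dagger M}$ be the trace norm. For $\epsilon \ge 0$, a completely positive, trace-preserving linear map $R : L(\mathbb{C}^d) \to L(\mathbb{C}^d)$ is called $\epsilon$-randomizing with respect to the trace norm if $\|R(\rho) - \mathbb{I}/d\|_{\mathrm{tr}} \le \epsilon$ for every density operator $\rho$, and completely randomizing if it is $0$-randomizing. Theorem. Let $\epsilon \in (0,2]$ and let $m$ be an integer with $$m \ge \frac{37 d}{\epsilon^2} \ln\left(\frac{15}{\epsilon}\right).$$ Let $\mu_1, \dots, \mu_m$ be Borel probability measures on the unitary group $U(\mathbb{C}^d)$, not necessarily equal, such that for each $i$ the map $\rho \mapsto \int U \rho U^\dagger \, d\mu_i(U)$ is completely randomizing. If $U_1, \dots, U_m$ are chosen independently, with $U_i$ distributed according to $\mu_i$, then with probability at least $1 - e^{-d/2}$ the map $$R(\rho) = \frac{1}{m} \sum_{i=1}^m U_i \rho U_i^\dagger$$ is $\epsilon$-randomizing with respect to the trace norm. -/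

import Mathlib

open MeasureTheory
open scoped ComplexOrder

noncomputable section

namespace QuantumRandomization

/-- A density operator (mixed state) on `ℂ^d`: positive semidefinite of trace one. -/
def IsDensity {d : ℕ} (ρ : Matrix (Fin d) (Fin d) ℂ) : Prop :=
  ρ.PosSemidef ∧ ρ.trace = 1

/-- The trace norm `Tr √(M† M)`. The square root is taken in the continuous functional calculus
of the Hermitian matrix `M† M`; its trace is a nonnegative real number, read off as a real. -/
def traceNorm {d : ℕ} (M : Matrix (Fin d) (Fin d) ℂ) : ℝ :=
  (cfc Real.sqrt (M.conjTranspose * M)).trace.re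

/-- The amplification `id_k ⊗ R`, applied blockwise to a `k × k` block matrix
with `d × d` blocks. -/
def amplify {d : ℕ} (R : Matrix (Fin d) (Fin d) ℂ →ₗ[ℂ] Matrix (Fin d) (Fin d) ℂ) (k : ℕ)
    (X : Matrix (Fin k × Fin d) (Fin k × Fin d) ℂ) :
    Matrix (Fin k × Fin d) (Fin k × Fin d) ℂ :=
  Matrix.of fun p q => R (Matrix.of fun a b => X (p.1, a) (q.1, b)) p.2 q.2

/-- Completely positive: every amplification preserves positive semidefiniteness. -/
def IsCompletelyPositive {d : ℕ}
    (R : Matrix (Fin d) (Fin d) ℂ →ₗ[ℂ] Matrix (Fin d) (Fin d) ℂ) : Prop :=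
  ∀ (k : ℕ) (X : Matrix (Fin k × Fin d) (Fin k × Fin d) ℂ),
    X.PosSemidef → (amplify R k X).PosSemidef

/-- Completely positive and trace preserving. -/
def IsCPTP {d : ℕ} (R : Matrix (Fin d) (Fin d) ℂ →ₗ[ℂ] Matrix (Fin d) (Fin d) ℂ) : Prop :=
  IsCompletelyPositive R ∧ ∀ A, (R A).trace = A.trace

/-- `R` is a CPTP map that sends every density operator to within `ε` of the completely mixed
state `I/d`, as measured by the norm `N`. -/
def IsRandomizing {d : ℕ} (N : Matrix (Fin d) (Fin d) ℂ → ℝ) (ε : ℝ)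
    (R : Matrix (Fin d) (Fin d) ℂ →ₗ[ℂ] Matrix (Fin d) (Fin d) ℂ) : Prop :=
  IsCPTP R ∧ ∀ ρ : Matrix (Fin d) (Fin d) ℂ, IsDensity ρ →
    N (R ρ - (d : ℂ)⁻¹ • (1 : Matrix (Fin d) (Fin d) ℂ)) ≤ ε

/-- Completely randomizing: `0`-randomizing. -/
def IsCompletelyRandomizing {d : ℕ}
    (R : Matrix (Fin d) (Fin d) ℂ →ₗ[ℂ] Matrix (Fin d) (Fin d) ℂ) : Prop :=
  IsRandomizing traceNorm 0 R

/-- The conjugation `ρ ↦ U ρ U†`. -/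
def conjMap {d : ℕ} (U : Matrix.unitaryGroup (Fin d) ℂ) :
    Matrix (Fin d) (Fin d) ℂ →ₗ[ℂ] Matrix (Fin d) (Fin d) ℂ where
  toFun ρ := (U : Matrix (Fin d) (Fin d) ℂ) * ρ * (U : Matrix (Fin d) (Fin d) ℂ).conjTranspose
  map_add' A B := by rw [mul_add, add_mul]
  map_smul' c A := by simp

/-- The uniform mixture `ρ ↦ (1/m) ∑ i, U i * ρ * (U i)†`. -/
def mixtureMap {d m : ℕ} (U : Fin m → Matrix.unitaryGroup (Fin d) ℂ) :
    Matrix (Fin d) (Fin d) ℂ →ₗ[ℂ] Matrix (Fin d) (Fin d) ℂ :=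
  (m : ℂ)⁻¹ • ∑ i, conjMap (U i)

/-- The unitary group carries its Borel σ-algebra. -/
instance instMeasurableSpaceUnitary (d : ℕ) : MeasurableSpace (Matrix.unitaryGroup (Fin d) ℂ) :=
  borel _

instance instBorelSpaceUnitary (d : ℕ) : BorelSpace (Matrix.unitaryGroup (Fin d) ℂ) :=
  ⟨rfl⟩

theorem continuous_conjMap_entry {d : ℕ} (ρ : Matrix (Fin d) (Fin d) ℂ) (a b : Fin d) :
    Continuous fun U : Matrix.unitaryGroup (Fin d) ℂ => conjMap U ρ a b := by
  have h : Continuous fun U : Matrix.unitaryGroup (Fin d) ℂ => conjMap U ρ :=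
    (continuous_subtype_val.matrix_mul continuous_const).matrix_mul
      continuous_subtype_val.matrix_conjTranspose
  exact h.matrix_elem a b

theorem norm_conjMap_entry_le {d : ℕ} (U : Matrix.unitaryGroup (Fin d) ℂ)
    (ρ : Matrix (Fin d) (Fin d) ℂ) (a b : Fin d) :
    ‖conjMap U ρ a b‖ ≤ ∑ j, ∑ i, ‖ρ i j‖ := by
  have hU : ∀ i j, ‖(U : Matrix (Fin d) (Fin d) ℂ) i j‖ ≤ 1 :=
    fun i j => entry_norm_bound_of_unitary U.2 i j
  change ‖((U : Matrix (Fin d) (Fin d) ℂ) * ρ *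
    (U : Matrix (Fin d) (Fin d) ℂ).conjTranspose) a b‖ ≤ _
  rw [Matrix.mul_apply]
  refine (norm_sum_le _ _).trans (Finset.sum_le_sum fun j _ => ?_)
  rw [norm_mul, Matrix.conjTranspose_apply, norm_star]
  refine (mul_le_of_le_one_right (norm_nonneg _) (hU b j)).trans ?_
  rw [Matrix.mul_apply]
  refine (norm_sum_le _ _).trans (Finset.sum_le_sum fun i _ => ?_)
  rw [norm_mul]
  exact mul_le_of_le_one_left (norm_nonneg _) (hU a i)

theorem integrable_conjMap_entry {d : ℕ} (μ : Measure (Matrix.unitaryGroup (Fin d) ℂ))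
    [IsProbabilityMeasure μ] (ρ : Matrix (Fin d) (Fin d) ℂ) (a b : Fin d) :
    Integrable (fun U => conjMap U ρ a b) μ :=
  Integrable.of_bound (continuous_conjMap_entry ρ a b).measurable.aestronglyMeasurable
    (∑ j, ∑ i, ‖ρ i j‖) (Filter.Eventually.of_forall fun U => norm_conjMap_entry_le U ρ a b)

/-- The map `ρ ↦ E[U ρ U†]` given by a probability distribution `μ` on the unitary group; the
matrix-valued expectation is taken entrywise. -/
def averageMap {d : ℕ} (μ : Measure (Matrix.unitaryGroup (Fin d) ℂ)) [IsProbabilityMeasure μ] :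
    Matrix (Fin d) (Fin d) ℂ →ₗ[ℂ] Matrix (Fin d) (Fin d) ℂ where
  toFun ρ := Matrix.of fun a b => ∫ U, conjMap U ρ a b ∂μ
  map_add' A B := by
    ext a b
    simp only [map_add, Matrix.add_apply, Matrix.of_apply]
    exact integral_add (integrable_conjMap_entry μ A a b) (integrable_conjMap_entry μ B a b)
  map_smul' c A := by
    ext a b
    simp only [map_smul, Matrix.smul_apply, Matrix.of_apply, smul_eq_mul, RingHom.id_apply]
    exact integral_const_mul _ _

end QuantumRandomization

end

namespace QuantumRandomization

open Matrix in
theorem traceNorm_eq_sum_abs_eigenvalues {d : ℕ} {M : Matrix (Fin d) (Fin d) ℂ}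
    (hM : M.IsHermitian) : traceNorm M = ∑ i, |hM.eigenvalues i| := by
  have hsa : IsSelfAdjoint M := hM
  have h1 : cfc Real.sqrt (Mᴴ * M) = cfc (fun x : ℝ => |x|) M := by
    rw [hM.eq, ← pow_two, ← cfc_pow_id (R := ℝ) M 2 hsa,
      ← cfc_comp' Real.sqrt (fun x : ℝ => x ^ 2) M (by fun_prop) (by fun_prop) hsa]
    simp only [Real.sqrt_sq_eq_abs]
  rw [traceNorm, h1, hM.cfc_eq, Matrix.IsHermitian.cfc, Unitary.conjStarAlgAut_apply,
    Matrix.trace_mul_cycle, Unitary.coe_star_mul_self, one_mul, Matrix.trace_diagonal]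
  simp

open Matrix in
theorem exists_unitary_diagonalization {d : ℕ} {M : Matrix (Fin d) (Fin d) ℂ}
    (hM : M.IsHermitian) : ∃ V : Matrix (Fin d) (Fin d) ℂ, Vᴴ * V = 1 ∧ V * Vᴴ = 1 ∧
      M = V * diagonal (fun i => (hM.eigenvalues i : ℂ)) * Vᴴ :=
  ⟨hM.eigenvectorUnitary, Unitary.coe_star_mul_self _, Unitary.coe_mul_star_self _, by
    conv_lhs => rw [hM.spectral_theorem, Unitary.conjStarAlgAut_apply]
    rfl⟩

open Matrix in
theorem sum_abs_eigenvalues_le {d : ℕ} {M P N : Matrix (Fin d) (Fin d) ℂ}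
    (hM : M.IsHermitian) (hP : P.PosSemidef) (hN : N.PosSemidef) (h : M = P - N) :
    ∑ i, |hM.eigenvalues i| ≤ P.trace.re + N.trace.re := by
  obtain ⟨V, h1, h2, hV⟩ := exists_unitary_diagonalization hM
  have tr : ∀ A : Matrix (Fin d) (Fin d) ℂ, A.trace.re = ∑ i, ((Vᴴ * A * V) i i).re := by
    intro A
    rw [← Complex.re_sum]
    change _ = (Matrix.trace (Vᴴ * A * V)).re
    rw [Matrix.trace_mul_cycle, h2, one_mul]
  have nn : ∀ A : Matrix (Fin d) (Fin d) ℂ, A.PosSemidef → ∀ i, 0 ≤ ((Vᴴ * A * V) i i).re :=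
    fun A hA i => (Complex.nonneg_iff.1 ((hA.conjTranspose_mul_mul_same V).diag_nonneg (i := i))).1
  rw [tr P, tr N, ← Finset.sum_add_distrib]
  refine Finset.sum_le_sum fun i _ => ?_
  have e : hM.eigenvalues i = ((Vᴴ * P * V) i i).re - ((Vᴴ * N * V) i i).re := by
    have e1 : Vᴴ * M * V = diagonal (fun i => (hM.eigenvalues i : ℂ)) := by
      conv_lhs => rw [hV]
      rw [← mul_assoc, ← mul_assoc, h1, one_mul, mul_assoc, h1, mul_one]
    rw [← Complex.sub_re, ← Matrix.sub_apply, ← sub_mul, ← mul_sub, ← h, e1, diagonal_apply_eq,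
      Complex.ofReal_re]
  rw [e]
  have h1 := nn P hP i
  have h2 := nn N hN i
  rw [abs_le]
  constructor <;> linarith

theorem traceNorm_sub_le {d : ℕ} {P N : Matrix (Fin d) (Fin d) ℂ}
    (hP : P.PosSemidef) (hN : N.PosSemidef) :
    traceNorm (P - N) ≤ P.trace.re + N.trace.re := by
  rw [traceNorm_eq_sum_abs_eigenvalues (hP.1.sub hN.1)]
  exact sum_abs_eigenvalues_le _ hP hN rfl

open Matrix in
/-- The Jordan decomposition of a Hermitian matrix attains the trace norm. -/
theorem exists_posSemidef_sub_eq {d : ℕ} {M : Matrix (Fin d) (Fin d) ℂ} (hM : M.IsHermitian) :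
    ∃ P N : Matrix (Fin d) (Fin d) ℂ, P.PosSemidef ∧ N.PosSemidef ∧ M = P - N ∧
      traceNorm M = P.trace.re + N.trace.re := by
  obtain ⟨V, h1, -, hV⟩ := exists_unitary_diagonalization hM
  have key : ∀ f : Fin d → ℝ, (∀ i, 0 ≤ f i) →
      (V * diagonal (fun i => (f i : ℂ)) * Vᴴ).PosSemidef ∧
      (V * diagonal (fun i => (f i : ℂ)) * Vᴴ).trace.re = ∑ i, f i := by
    intro f hf
    constructor
    · exact (Matrix.PosSemidef.diagonal fun i => by simpa using hf i).mul_mul_conjTranspose_same V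
    · rw [Matrix.trace_mul_cycle, h1, one_mul, Matrix.trace_diagonal]
      simp
  obtain ⟨p1, p2⟩ := key (fun i => (hM.eigenvalues i)⁺) fun i => posPart_nonneg _
  obtain ⟨n1, n2⟩ := key (fun i => (hM.eigenvalues i)⁻) fun i => negPart_nonneg _
  refine ⟨_, _, p1, n1, ?_, ?_⟩
  · rw [← sub_mul, ← mul_sub, diagonal_sub]
    conv_lhs => rw [hV]
    congr 3
    ext i
    rw [← Complex.ofReal_sub, posPart_sub_negPart]
  · rw [p2, n2, traceNorm_eq_sum_abs_eigenvalues hM, ← Finset.sum_add_distrib]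
    exact Finset.sum_congr rfl fun i _ => (posPart_add_negPart _).symm

theorem traceNorm_add_le {d : ℕ} {A B : Matrix (Fin d) (Fin d) ℂ} (hA : A.IsHermitian)
    (hB : B.IsHermitian) : traceNorm (A + B) ≤ traceNorm A + traceNorm B := by
  obtain ⟨P, N, hP, hN, e, t⟩ := exists_posSemidef_sub_eq hA
  obtain ⟨P', N', hP', hN', e', t'⟩ := exists_posSemidef_sub_eq hB
  have := traceNorm_sub_le (hP.add hP') (hN.add hN')
  rw [Matrix.trace_add, Matrix.trace_add, Complex.add_re, Complex.add_re] at this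
  rw [t, t', e, e', show P - N + (P' - N') = P + P' - (N + N') by abel]
  linarith

theorem traceNorm_smul_le {d : ℕ} {A : Matrix (Fin d) (Fin d) ℂ} (hA : A.IsHermitian)
    {c : ℝ} (hc : 0 ≤ c) : traceNorm ((c : ℂ) • A) ≤ c * traceNorm A := by
  obtain ⟨P, N, hP, hN, e, t⟩ := exists_posSemidef_sub_eq hA
  have hc' : (0 : ℂ) ≤ c := by simpa using hc
  have := traceNorm_sub_le (hP.smul hc') (hN.smul hc')
  rw [Matrix.trace_smul, Matrix.trace_smul, ← smul_sub, ← e] at this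
  rw [t]
  simpa [mul_add] using this

theorem traceNorm_nonneg {d : ℕ} {A : Matrix (Fin d) (Fin d) ℂ} (hA : A.IsHermitian) :
    0 ≤ traceNorm A := by
  rw [traceNorm_eq_sum_abs_eigenvalues hA]
  exact Finset.sum_nonneg fun i _ => abs_nonneg _

theorem eq_zero_of_traceNorm_le_zero {d : ℕ} {A : Matrix (Fin d) (Fin d) ℂ} (hA : A.IsHermitian)
    (h : traceNorm A ≤ 0) : A = 0 := by
  rw [traceNorm_eq_sum_abs_eigenvalues hA] at h
  refine hA.eigenvalues_eq_zero_iff.1 (funext fun i => ?_)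
  have := (Finset.sum_eq_zero_iff_of_nonneg fun i _ => abs_nonneg (hA.eigenvalues i)).1
    (le_antisymm h (Finset.sum_nonneg fun i _ => abs_nonneg _)) i (Finset.mem_univ i)
  simpa using this

theorem traceNorm_sq_le {d : ℕ} {M : Matrix (Fin d) (Fin d) ℂ} (hM : M.IsHermitian) :
    traceNorm M ^ 2 ≤ d * ∑ a, ∑ b, ‖M a b‖ ^ 2 := by
  have h1 : ∑ i, |hM.eigenvalues i| ^ 2 = ∑ a, ∑ b, ‖M a b‖ ^ 2 := by
    have e1 : (M * M).trace = ∑ i, ((hM.eigenvalues i : ℂ)) ^ 2 := by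
      have : M * M = Unitary.conjStarAlgAut ℂ _ hM.eigenvectorUnitary
          (Matrix.diagonal (RCLike.ofReal ∘ hM.eigenvalues) *
            Matrix.diagonal (RCLike.ofReal ∘ hM.eigenvalues)) := by
        rw [map_mul, ← hM.spectral_theorem]
      rw [this, Unitary.conjStarAlgAut_apply, Matrix.trace_mul_cycle, Unitary.coe_star_mul_self,
        one_mul, Matrix.diagonal_mul_diagonal, Matrix.trace_diagonal]
      simp [pow_two]
    have e2 : (M * M).trace = ((∑ a, ∑ b, ‖M a b‖ ^ 2 : ℝ) : ℂ) := by
      rw [Matrix.trace]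
      push_cast
      refine Finset.sum_congr rfl fun a _ => ?_
      rw [Matrix.diag_apply, Matrix.mul_apply]
      refine Finset.sum_congr rfl fun b _ => ?_
      rw [← hM.apply b a, ← Complex.mul_conj']
      rfl
    have e3 := e1.symm.trans e2
    simp only [sq_abs]
    exact_mod_cast e3
  rw [traceNorm_eq_sum_abs_eigenvalues hM, ← h1]
  simpa using sq_sum_le_card_mul_sum_sq (s := Finset.univ) (f := fun i => |hM.eigenvalues i|)

/-- The rank-one matrix `x x†`. -/
def pure {d : ℕ} (x : EuclideanSpace ℂ (Fin d)) : Matrix (Fin d) (Fin d) ℂ :=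
  Matrix.vecMulVec x (star x.ofLp)

theorem pure_apply {d : ℕ} (x : EuclideanSpace ℂ (Fin d)) (a b : Fin d) :
    pure x a b = x a * star (x b) := rfl

theorem posSemidef_pure {d : ℕ} (x : EuclideanSpace ℂ (Fin d)) : (pure x).PosSemidef :=
  Matrix.posSemidef_vecMulVec_self_star _

theorem trace_pure {d : ℕ} (x : EuclideanSpace ℂ (Fin d)) : (pure x).trace = (‖x‖ ^ 2 : ℝ) := by
  rw [EuclideanSpace.norm_sq_eq, Matrix.trace]
  push_cast
  refine Finset.sum_congr rfl fun a _ => ?_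
  rw [Matrix.diag_apply, pure_apply, ← Complex.mul_conj']
  rfl

theorem isDensity_pure {d : ℕ} {x : EuclideanSpace ℂ (Fin d)} (hx : ‖x‖ = 1) :
    IsDensity (pure x) := ⟨posSemidef_pure x, by rw [trace_pure, hx]; simp⟩

/-- Pure states at distance `‖x - y‖` have a difference that splits into two small positive
semidefinite parts. -/
theorem exists_pure_sub_pure_eq {d : ℕ} {x y : EuclideanSpace ℂ (Fin d)} (hx : ‖x‖ = 1)
    (hy : ‖y‖ = 1) : ∃ P N : Matrix (Fin d) (Fin d) ℂ, P.PosSemidef ∧ N.PosSemidef ∧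
      pure x - pure y = P - N ∧ P.trace.re + N.trace.re ≤ 2 * ‖x - y‖ := by
  rcases eq_or_ne x y with rfl | hxy
  · exact ⟨0, 0, .zero, .zero, by simp, by simp⟩
  have hb : 0 < ‖x - y‖ := norm_pos_iff.2 (sub_ne_zero.2 hxy)
  set t : ℝ := √(‖x - y‖ / 2) with ht
  have ht2 : t ^ 2 = ‖x - y‖ / 2 := Real.sq_sqrt (by positivity)
  have ht0 : t ≠ 0 := fun h => by rw [h] at ht2; simp at ht2; exact hb.ne' (by simpa using ht2.symm)
  set u : EuclideanSpace ℂ (Fin d) := (t : ℂ) • (x + y) with hu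
  set v : EuclideanSpace ℂ (Fin d) := (t : ℂ)⁻¹ • (x - y) with hv
  have hq : (0 : ℂ) ≤ (1 / 4 : ℝ) := by rw [Complex.zero_le_real]; norm_num
  refine ⟨((1 / 4 : ℝ) : ℂ) • pure (u + v), ((1 / 4 : ℝ) : ℂ) • pure (u - v),
    (posSemidef_pure _).smul hq, (posSemidef_pure _).smul hq, ?_, ?_⟩
  · ext a b
    have htc : (t : ℂ) ≠ 0 := by exact_mod_cast ht0
    simp only [Matrix.sub_apply, Matrix.smul_apply, pure_apply, hu, hv, PiLp.add_apply,
      PiLp.sub_apply, PiLp.smul_apply, smul_eq_mul, star_add, star_sub, star_mul', star_inv₀,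
      Complex.star_def, Complex.conj_ofReal]
    push_cast
    field_simp
    ring
  · have par := parallelogram_law_with_norm ℂ u v
    have nu : ‖u‖ ^ 2 ≤ ‖x - y‖ / 2 * 4 := by
      have : ‖x + y‖ ≤ 2 := (norm_add_le _ _).trans (by rw [hx, hy]; norm_num)
      rw [hu, norm_smul, mul_pow, Complex.norm_real, Real.norm_eq_abs, sq_abs, ht2]
      gcongr
      nlinarith [norm_nonneg (x + y)]
    have nv : ‖v‖ ^ 2 = 2 * ‖x - y‖ := by
      rw [hv, norm_smul, mul_pow, norm_inv, Complex.norm_real, Real.norm_eq_abs, inv_pow, sq_abs,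
        ht2]
      field_simp
    rw [Matrix.trace_smul, Matrix.trace_smul, trace_pure, trace_pure, smul_eq_mul, smul_eq_mul,
      ← Complex.ofReal_mul, ← Complex.ofReal_mul, Complex.ofReal_re, Complex.ofReal_re]
    nlinarith

end QuantumRandomization

/-- A finite `η`-net of the unit sphere obtained from a volume comparison. -/
theorem exists_net_unit_sphere (E : Type*) [NormedAddCommGroup E] [NormedSpace ℝ E]
    [FiniteDimensional ℝ E] {η : ℝ} (hη : 0 < η) :
    ∃ s : Finset E, (∀ c ∈ s, ‖c‖ = 1) ∧ (∀ x : E, ‖x‖ = 1 → ∃ c ∈ s, ‖x - c‖ ≤ η) ∧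
      (s.card : ℝ) ≤ (1 + 2 / η) ^ Module.finrank ℝ E := by
  have bound : ∀ s : Finset E, (∀ c ∈ s, ‖c‖ = 1) → (∀ c ∈ s, ∀ e ∈ s, c ≠ e → η < ‖c - e‖) →
      (s.card : ℝ) ≤ (1 + 2 / η) ^ Module.finrank ℝ E := by
    intro s hs h
    borelize E
    let μ : Measure E := Measure.addHaar
    have hδ : 0 < η / 2 := by positivity
    have hρ : 0 < 1 + η / 2 := by positivity
    have D : Set.Pairwise (s : Set E) (Function.onFun Disjoint fun c => Metric.ball c (η / 2)) := by
      rintro c hc e he hce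
      apply Metric.ball_disjoint_ball
      rw [dist_eq_norm]
      have := h c hc e he hce
      linarith
    have A_subset : (⋃ c ∈ s, Metric.ball c (η / 2)) ⊆ Metric.ball (0 : E) (1 + η / 2) := by
      refine Set.iUnion₂_subset fun x hx => Metric.ball_subset_ball' ?_
      rw [dist_zero_right, hs x hx, add_comm]
    have I : (s.card : ENNReal) * ENNReal.ofReal ((η / 2) ^ Module.finrank ℝ E) *
        μ (Metric.ball 0 1) ≤
        ENNReal.ofReal ((1 + η / 2) ^ Module.finrank ℝ E) * μ (Metric.ball 0 1) :=
      calc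
        _ = μ (⋃ c ∈ s, Metric.ball c (η / 2)) := by
          rw [measure_biUnion_finset D fun c _ => measurableSet_ball]
          simp only [μ.addHaar_ball_of_pos _ hδ, Finset.sum_const, nsmul_eq_mul, mul_assoc]
        _ ≤ μ (Metric.ball (0 : E) (1 + η / 2)) := measure_mono A_subset
        _ = _ := by simp only [μ.addHaar_ball_of_pos _ hρ]
    have J := (ENNReal.mul_le_mul_iff_left
      (Metric.measure_ball_pos _ _ zero_lt_one).ne' measure_ball_lt_top.ne).1 I
    have K := ENNReal.toReal_le_of_le_ofReal (pow_nonneg hρ.le _) J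
    rw [ENNReal.toReal_mul, ENNReal.toReal_natCast, ENNReal.toReal_ofReal (by positivity)] at K
    rw [show 1 + 2 / η = (1 + η / 2) / (η / 2) by field_simp; ring, div_pow,
      le_div_iff₀ (by positivity)]
    exact K
  -- a separated set of maximal cardinality is a net
  let Sep : ℕ → Prop := fun n => ∃ s : Finset E, s.card = n ∧ (∀ c ∈ s, ‖c‖ = 1) ∧
    ∀ c ∈ s, ∀ e ∈ s, c ≠ e → η < ‖c - e‖
  have h0 : Sep 0 := ⟨∅, by simp⟩
  have hb : ∀ n, Sep n → n ≤ ⌊(1 + 2 / η) ^ Module.finrank ℝ E⌋₊ := by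
    rintro n ⟨s, rfl, h1, h2⟩
    exact Nat.le_floor (bound s h1 h2)
  classical
  obtain ⟨s, hs, h1, h2⟩ : Sep (Nat.findGreatest Sep ⌊(1 + 2 / η) ^ Module.finrank ℝ E⌋₊) :=
    Nat.findGreatest_spec (P := Sep) (Nat.zero_le _) h0
  refine ⟨s, h1, fun x hx => ?_, bound s h1 h2⟩
  by_contra! hcon
  have hxs : x ∉ s := fun hx' => by simpa using (hcon x hx').trans' hη
  have hS : Sep (s.card + 1) := by
    refine ⟨insert x s, Finset.card_insert_of_notMem hxs, ?_, ?_⟩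
    · intro c hc
      rcases Finset.mem_insert.1 hc with rfl | hc
      exacts [hx, h1 c hc]
    · intro c hc e he hce
      rcases Finset.mem_insert.1 hc with hcx | hc <;> rcases Finset.mem_insert.1 he with hex | he
      · exact absurd (hcx.trans hex.symm) hce
      · exact hcx ▸ hcon e he
      · rw [norm_sub_rev]; exact hex ▸ hcon c hc
      · exact h2 c hc e he hce
  have := Nat.le_findGreatest (hb _ hS) hS
  omega

/-- Bound on the moment generating function of a function with bounded differences. -/
theorem integral_exp_le_of_bounded_differences {Ω : Type*} [MeasurableSpace Ω] {c : ℝ}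
    (l : ℝ) (m : ℕ) (μ : Fin m → Measure Ω) [∀ i, IsProbabilityMeasure (μ i)]
    (f : (Fin m → Ω) → ℝ) (hf : Measurable f) {B : ℝ} (hB : ∀ x, |f x| ≤ B)
    (hd : ∀ x i y, |f x - f (Function.update x i y)| ≤ c) :
    ∫ x, Real.exp (l * f x) ∂Measure.pi μ ≤
      Real.exp (l * ∫ x, f x ∂Measure.pi μ + m * (c ^ 2 * l ^ 2 / 8)) := by
  induction m with
  | zero =>
    rw [Measure.pi_of_empty, integral_dirac, integral_dirac]
    simp
  | succ m ih =>
    have mp := (measurePreserving_piFinSuccAbove μ 0).symm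
    let ν : Measure (Fin m → Ω) := Measure.pi fun j => μ (Fin.succAbove 0 j)
    have hcons : ∀ z : Ω × (Fin m → Ω),
        (MeasurableEquiv.piFinSuccAbove (fun _ : Fin (m + 1) => Ω) 0).symm z =
          Fin.cons z.1 z.2 := by
      intro z
      simp [MeasurableEquiv.piFinSuccAbove, Fin.insertNthEquiv]
    have mcons : Measurable fun z : Ω × (Fin m → Ω) => (Fin.cons z.1 z.2 : Fin (m + 1) → Ω) := by
      simp_rw [← hcons]
      exact MeasurableEquiv.measurable _
    have e1 : ∀ g : (Fin (m + 1) → Ω) → ℝ, ∫ x, g x ∂Measure.pi μ =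
        ∫ z, g (Fin.cons z.1 z.2) ∂(μ 0).prod ν := by
      intro g
      rw [← mp.integral_comp']
      simp_rw [hcons]
      rfl
    have mF : Measurable fun z : Ω × (Fin m → Ω) => f (Fin.cons z.1 z.2) := hf.comp mcons
    have iF : Integrable (fun z : Ω × (Fin m → Ω) => f (Fin.cons z.1 z.2)) ((μ 0).prod ν) :=
      Integrable.of_bound mF.aestronglyMeasurable B (.of_forall fun z => hB _)
    have hexp : ∀ t, |t| ≤ B → ‖Real.exp (l * t)‖ ≤ Real.exp (|l| * B) := by
      intro t ht
      rw [Real.norm_eq_abs, Real.abs_exp]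
      exact Real.exp_le_exp.2 ((le_abs_self _).trans (by rw [abs_mul]; gcongr))
    have iG : Integrable (fun z : Ω × (Fin m → Ω) => Real.exp (l * f (Fin.cons z.1 z.2)))
        ((μ 0).prod ν) :=
      Integrable.of_bound (mF.const_mul l).exp.aestronglyMeasurable (Real.exp (|l| * B))
        (.of_forall fun z => hexp _ (hB _))
    rw [e1, e1, integral_prod _ iG, integral_prod _ iF]
    set g : Ω → ℝ := fun x => ∫ y, f (Fin.cons x y) ∂ν with hg
    have mx : ∀ x, Measurable fun y : Fin m → Ω => f (Fin.cons x y) := fun x =>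
      mF.comp measurable_prodMk_left
    have ix : ∀ x, Integrable (fun y : Fin m → Ω => f (Fin.cons x y)) ν := fun x =>
      Integrable.of_bound (mx x).aestronglyMeasurable B (.of_forall fun z => hB _)
    have mg : Measurable g := (mF.stronglyMeasurable.integral_prod_right (ν := ν)).measurable
    have gB : ∀ x, |g x| ≤ B := by
      intro x
      have := norm_integral_le_of_norm_le_const (μ := ν) (f := fun y => f (Fin.cons x y))
        (.of_forall fun y => hB (Fin.cons x y))
      simpa using this
    have gd : ∀ x x', g x - g x' ≤ c := by
      intro x x'
      rw [hg]
      simp only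
      rw [← integral_sub (ix x) (ix x')]
      have := integral_mono (μ := ν) ((ix x).sub (ix x')) (integrable_const c) (fun y => by
        have := hd (Fin.cons x y) 0 x'
        rw [Fin.update_cons_zero] at this
        exact (le_abs_self _).trans this)
      simpa using this
    have step : ∀ x, ∫ y, Real.exp (l * f (Fin.cons x y)) ∂ν ≤
        Real.exp (l * g x + m * (c ^ 2 * l ^ 2 / 8)) := by
      intro x
      refine ih (fun j => μ (Fin.succAbove 0 j)) (fun y => f (Fin.cons x y)) (mx x)
        (fun y => hB _) ?_
      intro y i w
      have := hd (Fin.cons x y) i.succ w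
      rwa [← Fin.cons_update] at this
    have hne : Nonempty Ω := (μ 0).nonempty_of_neZero
    have gbdd : BddBelow (Set.range g) := ⟨-B, by rintro _ ⟨x, rfl⟩; exact (abs_le.1 (gB x)).1⟩
    have gmem : ∀ x, g x ∈ Set.Icc (⨅ x, g x) ((⨅ x, g x) + c) := by
      intro x
      refine ⟨ciInf_le gbdd x, ?_⟩
      have : g x - c ≤ ⨅ x, g x := le_ciInf fun x' => by linarith [gd x x']
      linarith
    have hsub := (ProbabilityTheory.hasSubgaussianMGF_of_mem_Icc (μ := μ 0) mg.aemeasurable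
      (.of_forall gmem)).mgf_le l
    have hconst : ((((‖(⨅ x, g x) + c - ⨅ x, g x‖₊ / 2) ^ 2 : NNReal)) : ℝ) * l ^ 2 / 2 =
        c ^ 2 * l ^ 2 / 8 := by
      push_cast
      rw [add_sub_cancel_left, Real.norm_eq_abs, div_pow, sq_abs]
      ring
    rw [hconst, ProbabilityTheory.mgf] at hsub
    have iexpg : Integrable (fun x => Real.exp (l * g x + m * (c ^ 2 * l ^ 2 / 8))) (μ 0) := by
      simp_rw [Real.exp_add]
      refine Integrable.mul_const ?_ _
      exact Integrable.of_bound (mg.const_mul l).exp.aestronglyMeasurable (Real.exp (|l| * B))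
        (.of_forall fun z => hexp _ (gB _))
    calc ∫ x, ∫ y, Real.exp (l * f (Fin.cons x y)) ∂ν ∂μ 0
        ≤ ∫ x, Real.exp (l * g x + m * (c ^ 2 * l ^ 2 / 8)) ∂μ 0 :=
          integral_mono iG.integral_prod_left iexpg step
      _ = (∫ x, Real.exp (l * (g x - ∫ x, g x ∂μ 0)) ∂μ 0) *
            Real.exp (l * (∫ x, g x ∂μ 0) + m * (c ^ 2 * l ^ 2 / 8)) := by
          rw [← integral_mul_const]
          refine integral_congr_ae (.of_forall fun x => ?_)
          simp only
          rw [← Real.exp_add]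
          congr 1
          ring
      _ ≤ Real.exp (c ^ 2 * l ^ 2 / 8) *
            Real.exp (l * (∫ x, g x ∂μ 0) + m * (c ^ 2 * l ^ 2 / 8)) := by gcongr
      _ = _ := by
          rw [← Real.exp_add]
          congr 1
          push_cast
          ring

/-- McDiarmid's inequality: concentration of a function with bounded differences. -/
theorem measure_ge_le_of_bounded_differences {Ω : Type*} [MeasurableSpace Ω] {c : ℝ}
    (hc : 0 < c) {m : ℕ} (hm : 0 < m) (μ : Fin m → Measure Ω) [∀ i, IsProbabilityMeasure (μ i)]
    (f : (Fin m → Ω) → ℝ) (hf : Measurable f) {B : ℝ} (hB : ∀ x, |f x| ≤ B)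
    (hd : ∀ x i y, |f x - f (Function.update x i y)| ≤ c) {t : ℝ} (ht : 0 ≤ t) :
    (Measure.pi μ).real {x | (∫ x, f x ∂Measure.pi μ) + t ≤ f x} ≤
      Real.exp (-(2 * t ^ 2 / (m * c ^ 2))) := by
  have hm' : (0 : ℝ) < m := by exact_mod_cast hm
  set l : ℝ := 4 * t / (m * c ^ 2) with hl
  have hl0 : 0 ≤ l := by positivity
  have hi : Integrable (fun x => Real.exp (l * f x)) (Measure.pi μ) := by
    refine Integrable.of_bound (hf.const_mul l).exp.aestronglyMeasurable (Real.exp (l * B))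
      (.of_forall fun x => ?_)
    rw [Real.norm_eq_abs, Real.abs_exp]
    gcongr
    exact (le_abs_self _).trans (hB x)
  refine (ProbabilityTheory.measure_ge_le_exp_mul_mgf _ hl0 hi).trans ?_
  refine (mul_le_mul_of_nonneg_left
    (integral_exp_le_of_bounded_differences l m μ f hf hB hd) (Real.exp_nonneg _)).trans ?_
  rw [← Real.exp_add]
  refine Real.exp_le_exp.2 (le_of_eq ?_)
  rw [hl]
  field_simp
  ring

theorem integral_sq_average_sub_le {Ω : Type*} [MeasurableSpace Ω] {m : ℕ} (hm : 0 < m)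
    (μ : Fin m → Measure Ω) [∀ i, IsProbabilityMeasure (μ i)] {X : Fin m → Ω → ℝ} {c : ℝ}
    (hX : ∀ i, MemLp (X i) 2 (μ i)) (hc : ∀ i, ∫ x, X i x ∂μ i = c) :
    ∫ x, ((m : ℝ)⁻¹ * ∑ i, X i (x i) - c) ^ 2 ∂Measure.pi μ ≤
      (m : ℝ)⁻¹ ^ 2 * ∑ i, ∫ x, X i x ^ 2 ∂μ i := by
  have hm' : (m : ℝ) ≠ 0 := by exact_mod_cast hm.ne'
  have hXi : ∀ i, MemLp (fun x : Fin m → Ω => X i (x i)) 2 (Measure.pi μ) := fun i =>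
    (hX i).comp_measurePreserving (measurePreserving_eval μ i)
  have hS : MemLp (fun x : Fin m → Ω => (m : ℝ)⁻¹ * ∑ i, X i (x i)) 2 (Measure.pi μ) :=
    (memLp_finsetSum _ fun i _ => hXi i).const_mul _
  have hE : ∫ x, (m : ℝ)⁻¹ * ∑ i, X i (x i) ∂Measure.pi μ = c := by
    rw [integral_const_mul, integral_finsetSum _ fun i _ => (hXi i).integrable one_le_two]
    have : ∀ i, ∫ x : Fin m → Ω, X i (x i) ∂Measure.pi μ = c := by
      intro i
      rw [integral_comp_eval (μ := μ) (hX i).aestronglyMeasurable, hc]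
    simp only [this, Finset.sum_const, Finset.card_univ, Fintype.card_fin, nsmul_eq_mul]
    field_simp
  have hV := ProbabilityTheory.variance_eq_integral hS.aestronglyMeasurable.aemeasurable
  rw [hE] at hV
  rw [← hV, ProbabilityTheory.variance_const_mul]
  have := ProbabilityTheory.variance_sum_pi hX
  have e : (∑ i, fun x : Fin m → Ω => X i (x i)) = fun x => ∑ i, X i (x i) := by
    ext x; simp
  rw [← e, this]
  gcongr with i
  rw [ProbabilityTheory.variance_eq_sub (hX i)]
  simp only [Pi.pow_apply]
  linarith [sq_nonneg (∫ x, X i x ∂μ i)]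

theorem integral_norm_sq_average_sub_le {Ω : Type*} [MeasurableSpace Ω] {m : ℕ} (hm : 0 < m)
    (μ : Fin m → Measure Ω) [∀ i, IsProbabilityMeasure (μ i)] {X : Fin m → Ω → ℂ} {c : ℂ}
    (hX : ∀ i, MemLp (X i) 2 (μ i)) (hc : ∀ i, ∫ x, X i x ∂μ i = c) :
    ∫ x, ‖(m : ℂ)⁻¹ * ∑ i, X i (x i) - c‖ ^ 2 ∂Measure.pi μ ≤
      (m : ℝ)⁻¹ ^ 2 * ∑ i, ∫ x, ‖X i x‖ ^ 2 ∂μ i := by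
  have sq : ∀ z : ℂ, ‖z‖ ^ 2 = z.re ^ 2 + z.im ^ 2 := fun z => by
    rw [← Complex.normSq_eq_norm_sq, Complex.normSq_apply]; ring
  have h1 : ∀ i, MemLp (fun x => (X i x).re) 2 (μ i) := fun i => (hX i).re
  have h2 : ∀ i, MemLp (fun x => (X i x).im) 2 (μ i) := fun i => (hX i).im
  have c1 : ∀ i, ∫ x, (X i x).re ∂μ i = c.re := fun i => by
    rw [← hc i]; exact integral_re ((hX i).integrable one_le_two)
  have c2 : ∀ i, ∫ x, (X i x).im ∂μ i = c.im := fun i => by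
    rw [← hc i]; exact integral_im ((hX i).integrable one_le_two)
  have avg : ∀ {Y : Fin m → Ω → ℝ} (a : ℝ), (∀ i, MemLp (Y i) 2 (μ i)) →
      Integrable (fun x => ((m : ℝ)⁻¹ * ∑ i, Y i (x i) - a) ^ 2) (Measure.pi μ) := by
    intro Y a hY
    have h : ∀ i, MemLp (fun x : Fin m → Ω => Y i (x i)) 2 (Measure.pi μ) := fun i =>
      (hY i).comp_measurePreserving (measurePreserving_eval μ i)
    have h' : MemLp (fun x : Fin m → Ω => (m : ℝ)⁻¹ * ∑ i, Y i (x i)) 2 (Measure.pi μ) :=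
      (memLp_finsetSum _ fun i _ => h i).const_mul _
    exact (h'.sub (memLp_const a)).integrable_sq
  have e : ∀ x : Fin m → Ω, ‖(m : ℂ)⁻¹ * ∑ i, X i (x i) - c‖ ^ 2 =
      ((m : ℝ)⁻¹ * ∑ i, (X i (x i)).re - c.re) ^ 2 +
      ((m : ℝ)⁻¹ * ∑ i, (X i (x i)).im - c.im) ^ 2 := by
    intro x
    rw [sq, Complex.sub_re, Complex.sub_im, ← Complex.ofReal_natCast, ← Complex.ofReal_inv,
      Complex.re_ofReal_mul, Complex.im_ofReal_mul, Complex.re_sum, Complex.im_sum]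
  simp_rw [e]
  rw [integral_add (avg _ h1) (avg _ h2)]
  refine (add_le_add (integral_sq_average_sub_le hm μ h1 c1)
    (integral_sq_average_sub_le hm μ h2 c2)).trans (le_of_eq ?_)
  rw [← mul_add, ← Finset.sum_add_distrib]
  congr 1
  refine Finset.sum_congr rfl fun i _ => ?_
  rw [← integral_add (h1 i).integrable_sq (h2 i).integrable_sq]
  simp_rw [sq]

namespace QuantumRandomization

instance secondCountableTopology_unitaryGroup (d : ℕ) :
    SecondCountableTopology (Matrix.unitaryGroup (Fin d) ℂ) :=
  haveI : SecondCountableTopology (Matrix (Fin d) (Fin d) ℂ) :=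
    inferInstanceAs (SecondCountableTopology (Fin d → Fin d → ℂ))
  TopologicalSpace.Subtype.secondCountableTopology
    (Matrix.unitaryGroup (Fin d) ℂ : Set (Matrix (Fin d) (Fin d) ℂ))

variable {d m : ℕ}

theorem conjMap_apply (U : Matrix.unitaryGroup (Fin d) ℂ) (A : Matrix (Fin d) (Fin d) ℂ) :
    conjMap U A = (U : Matrix (Fin d) (Fin d) ℂ) * A *
      (U : Matrix (Fin d) (Fin d) ℂ).conjTranspose := rfl

theorem mixtureMap_apply (U : Fin m → Matrix.unitaryGroup (Fin d) ℂ)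
    (A : Matrix (Fin d) (Fin d) ℂ) : mixtureMap U A = (m : ℂ)⁻¹ • ∑ i, conjMap (U i) A := by
  simp [mixtureMap]

theorem mixtureMap_apply_apply (U : Fin m → Matrix.unitaryGroup (Fin d) ℂ)
    (A : Matrix (Fin d) (Fin d) ℂ) (a b : Fin d) :
    mixtureMap U A a b = (m : ℂ)⁻¹ * ∑ i, conjMap (U i) A a b := by
  rw [mixtureMap_apply, Matrix.smul_apply, Matrix.sum_apply, smul_eq_mul]

theorem posSemidef_conjMap (U : Matrix.unitaryGroup (Fin d) ℂ) {A : Matrix (Fin d) (Fin d) ℂ}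
    (hA : A.PosSemidef) : (conjMap U A).PosSemidef :=
  hA.mul_mul_conjTranspose_same (U : Matrix (Fin d) (Fin d) ℂ)

theorem trace_conjMap (U : Matrix.unitaryGroup (Fin d) ℂ) (A : Matrix (Fin d) (Fin d) ℂ) :
    (conjMap U A).trace = A.trace := by
  rw [conjMap_apply, Matrix.trace_mul_cycle]
  have : (U : Matrix (Fin d) (Fin d) ℂ).conjTranspose * (U : Matrix (Fin d) (Fin d) ℂ) = 1 :=
    Unitary.coe_star_mul_self U
  rw [this, one_mul]

theorem inv_natCast_nonneg (n : ℕ) : (0 : ℂ) ≤ (n : ℂ)⁻¹ := by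
  rw [← Complex.ofReal_natCast, ← Complex.ofReal_inv, Complex.zero_le_real]
  positivity

theorem posSemidef_mixtureMap (U : Fin m → Matrix.unitaryGroup (Fin d) ℂ)
    {A : Matrix (Fin d) (Fin d) ℂ} (hA : A.PosSemidef) : (mixtureMap U A).PosSemidef := by
  rw [mixtureMap_apply]
  exact (Matrix.posSemidef_sum _ fun i _ => posSemidef_conjMap (U i) hA).smul
    (inv_natCast_nonneg m)

theorem trace_mixtureMap (hm : 0 < m) (U : Fin m → Matrix.unitaryGroup (Fin d) ℂ)
    (A : Matrix (Fin d) (Fin d) ℂ) : (mixtureMap U A).trace = A.trace := by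
  have : (m : ℂ) ≠ 0 := by exact_mod_cast hm.ne'
  rw [mixtureMap_apply, Matrix.trace_smul, Matrix.trace_sum]
  simp [trace_conjMap, this]

theorem isHermitian_maximallyMixed (d : ℕ) :
    ((d : ℂ)⁻¹ • (1 : Matrix (Fin d) (Fin d) ℂ)).IsHermitian :=
  (Matrix.PosSemidef.one.smul (inv_natCast_nonneg d)).1

open scoped Kronecker in
theorem amplify_conjMap (U : Matrix.unitaryGroup (Fin d) ℂ) (k : ℕ)
    (X : Matrix (Fin k × Fin d) (Fin k × Fin d) ℂ) :
    amplify (conjMap U) k X = ((1 : Matrix (Fin k) (Fin k) ℂ) ⊗ₖ (U : Matrix (Fin d) (Fin d) ℂ)) *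
      X * ((1 : Matrix (Fin k) (Fin k) ℂ) ⊗ₖ (U : Matrix (Fin d) (Fin d) ℂ)).conjTranspose := by
  ext p q
  simp [amplify, conjMap_apply, Matrix.mul_apply, Fintype.sum_prod_type, Matrix.kroneckerMap_apply,
    Matrix.one_apply, ite_mul, apply_ite]

theorem isCPTP_mixtureMap (hm : 0 < m) (U : Fin m → Matrix.unitaryGroup (Fin d) ℂ) :
    IsCPTP (mixtureMap U) := by
  refine ⟨fun k X hX => ?_, trace_mixtureMap hm U⟩
  have : amplify (mixtureMap U) k X = (m : ℂ)⁻¹ • ∑ i, amplify (conjMap (U i)) k X := by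
    ext p q
    rw [Matrix.smul_apply, Matrix.sum_apply]
    exact mixtureMap_apply_apply _ _ _ _
  rw [this]
  refine (Matrix.posSemidef_sum _ fun i _ => ?_).smul (inv_natCast_nonneg m)
  rw [amplify_conjMap]
  exact hX.mul_mul_conjTranspose_same _

/-- Trace-norm deviation of the output of a mixture of unitaries from the maximally mixed state. -/
noncomputable def deviation (U : Fin m → Matrix.unitaryGroup (Fin d) ℂ) (ρ : Matrix (Fin d) (Fin d) ℂ) : ℝ :=
  traceNorm (mixtureMap U ρ - (d : ℂ)⁻¹ • (1 : Matrix (Fin d) (Fin d) ℂ))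

theorem isHermitian_mixtureMap_sub (U : Fin m → Matrix.unitaryGroup (Fin d) ℂ)
    {ρ : Matrix (Fin d) (Fin d) ℂ} (hρ : ρ.PosSemidef) :
    (mixtureMap U ρ - (d : ℂ)⁻¹ • (1 : Matrix (Fin d) (Fin d) ℂ)).IsHermitian :=
  (posSemidef_mixtureMap U hρ).1.sub (isHermitian_maximallyMixed d)

theorem deviation_le_add (U V : Fin m → Matrix.unitaryGroup (Fin d) ℂ)
    {ρ σ : Matrix (Fin d) (Fin d) ℂ} (hρ : ρ.PosSemidef) (hσ : σ.PosSemidef) :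
    deviation U ρ ≤ deviation V σ + traceNorm (mixtureMap U ρ - mixtureMap V σ) := by
  have := traceNorm_add_le (isHermitian_mixtureMap_sub V hσ)
    ((posSemidef_mixtureMap U hρ).1.sub (posSemidef_mixtureMap V hσ).1)
  refine le_trans (le_of_eq ?_) this
  rw [deviation]
  congr 1
  abel

theorem deviation_pure_le (hm : 0 < m) (U : Fin m → Matrix.unitaryGroup (Fin d) ℂ)
    {x y : EuclideanSpace ℂ (Fin d)} (hx : ‖x‖ = 1) (hy : ‖y‖ = 1) :
    deviation U (pure x) ≤ deviation U (pure y) + 2 * ‖x - y‖ := by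
  refine (deviation_le_add U U (posSemidef_pure x) (posSemidef_pure y)).trans ?_
  obtain ⟨P, N, hP, hN, e, h⟩ := exists_pure_sub_pure_eq hx hy
  rw [← map_sub, e, map_sub]
  have := traceNorm_sub_le (posSemidef_mixtureMap U hP) (posSemidef_mixtureMap U hN)
  rw [trace_mixtureMap hm, trace_mixtureMap hm] at this
  linarith

theorem abs_deviation_sub_update_le {ρ : Matrix (Fin d) (Fin d) ℂ} (hρ : IsDensity ρ)
    (U : Fin m → Matrix.unitaryGroup (Fin d) ℂ) (i : Fin m) (V : Matrix.unitaryGroup (Fin d) ℂ) :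
    |deviation U ρ - deviation (Function.update U i V) ρ| ≤ 2 / m := by
  have key : ∀ (U : Fin m → Matrix.unitaryGroup (Fin d) ℂ) (V : Matrix.unitaryGroup (Fin d) ℂ),
      deviation U ρ ≤ deviation (Function.update U i V) ρ + 2 / m := by
    intro U V
    refine (deviation_le_add U (Function.update U i V) hρ.1 hρ.1).trans ?_
    gcongr
    have e : mixtureMap U ρ - mixtureMap (Function.update U i V) ρ =
        (m : ℂ)⁻¹ • conjMap (U i) ρ - (m : ℂ)⁻¹ • conjMap V ρ := by
      rw [mixtureMap_apply, mixtureMap_apply, ← smul_sub, ← smul_sub, ← Finset.sum_sub_distrib]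
      rw [Finset.sum_eq_single i]
      · simp
      · intro j _ hj
        simp [Function.update_of_ne hj]
      · simp
    rw [e]
    refine (traceNorm_sub_le ((posSemidef_conjMap _ hρ.1).smul (inv_natCast_nonneg m))
      ((posSemidef_conjMap _ hρ.1).smul (inv_natCast_nonneg m))).trans (le_of_eq ?_)
    rw [Matrix.trace_smul, Matrix.trace_smul, trace_conjMap, trace_conjMap, hρ.2, smul_eq_mul,
      mul_one, ← Complex.ofReal_natCast, ← Complex.ofReal_inv, Complex.ofReal_re]
    ring
  rw [abs_sub_le_iff]
  have h2 := key (Function.update U i V) (U i)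
  rw [Function.update_idem, Function.update_eq_self] at h2
  constructor <;> linarith [key U V]

theorem deviation_nonneg (U : Fin m → Matrix.unitaryGroup (Fin d) ℂ)
    {ρ : Matrix (Fin d) (Fin d) ℂ} (hρ : ρ.PosSemidef) : 0 ≤ deviation U ρ :=
  traceNorm_nonneg (isHermitian_mixtureMap_sub U hρ)

theorem deviation_le_two (hd : 0 < d) (hm : 0 < m) (U : Fin m → Matrix.unitaryGroup (Fin d) ℂ)
    {ρ : Matrix (Fin d) (Fin d) ℂ} (hρ : IsDensity ρ) : deviation U ρ ≤ 2 := by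
  have hd' : (d : ℂ) ≠ 0 := by exact_mod_cast hd.ne'
  refine (traceNorm_sub_le (posSemidef_mixtureMap U hρ.1)
    (Matrix.PosSemidef.one.smul (inv_natCast_nonneg d))).trans (le_of_eq ?_)
  rw [trace_mixtureMap hm, hρ.2, Matrix.trace_smul, Matrix.trace_one, smul_eq_mul, Fintype.card_fin,
    inv_mul_cancel₀ hd', Complex.one_re]
  norm_num

theorem continuous_deviation {ρ : Matrix (Fin d) (Fin d) ℂ} (hρ : ρ.PosSemidef) :
    Continuous fun U : Fin m → Matrix.unitaryGroup (Fin d) ℂ => deviation U ρ := by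
  rw [continuous_iff_continuousAt]
  intro V
  have hc : Continuous fun U : Fin m → Matrix.unitaryGroup (Fin d) ℂ =>
      √(d * ∑ a, ∑ b, ‖(mixtureMap U ρ - mixtureMap V ρ) a b‖ ^ 2) := by
    simp only [Matrix.sub_apply, mixtureMap_apply_apply]
    have : ∀ i a b, Continuous fun U : Fin m → Matrix.unitaryGroup (Fin d) ℂ =>
      conjMap (U i) ρ a b := fun i a b => (continuous_conjMap_entry ρ a b).comp (continuous_apply i)
    fun_prop
  have h0 := hc.tendsto V
  simp only [sub_self, Matrix.zero_apply, norm_zero, ne_eq, OfNat.ofNat_ne_zero, not_false_eq_true,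
    zero_pow, Finset.sum_const_zero, mul_zero, Real.sqrt_zero] at h0
  have bd : ∀ U W : Fin m → Matrix.unitaryGroup (Fin d) ℂ, deviation U ρ ≤ deviation W ρ +
      √(d * ∑ a, ∑ b, ‖(mixtureMap U ρ - mixtureMap W ρ) a b‖ ^ 2) := by
    intro U W
    refine (deviation_le_add U W hρ hρ).trans ?_
    gcongr
    exact Real.le_sqrt_of_sq_le (traceNorm_sq_le
      ((posSemidef_mixtureMap U hρ).1.sub (posSemidef_mixtureMap W hρ).1))
  rw [ContinuousAt, tendsto_iff_dist_tendsto_zero]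
  refine squeeze_zero (fun _ => dist_nonneg) (fun U => ?_) h0
  rw [Real.dist_eq, abs_sub_le_iff]
  have h2 := bd V U
  simp only [Matrix.sub_apply, norm_sub_rev (mixtureMap V ρ _ _)] at h2
  constructor
  · linarith [bd U V]
  · simp only [Matrix.sub_apply]
    linarith

theorem measurable_deviation {ρ : Matrix (Fin d) (Fin d) ℂ} (hρ : ρ.PosSemidef) :
    Measurable fun U : Fin m → Matrix.unitaryGroup (Fin d) ℂ => deviation U ρ :=
  (continuous_deviation hρ).measurable

theorem sum_norm_sq_conjMap_pure (U : Matrix.unitaryGroup (Fin d) ℂ)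
    {x : EuclideanSpace ℂ (Fin d)} (hx : ‖x‖ = 1) :
    ∑ a, ∑ b, ‖conjMap U (pure x) a b‖ ^ 2 = 1 := by
  set y : EuclideanSpace ℂ (Fin d) := WithLp.toLp 2 (Matrix.mulVec U x) with hy
  have e : conjMap U (pure x) = pure y := by
    rw [conjMap_apply, pure, pure, Matrix.mul_vecMulVec, Matrix.vecMulVec_mul, hy,
      Matrix.star_mulVec]
  have hn : ‖y‖ ^ 2 = 1 := by
    have := trace_conjMap U (pure x)
    rw [e, trace_pure, trace_pure, hx] at this
    simpa using Complex.ofReal_injective this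
  rw [e]
  simp only [pure_apply, norm_mul, norm_star, mul_pow]
  simp only [← Finset.mul_sum, ← EuclideanSpace.norm_sq_eq, hn, mul_one]

theorem posSemidef_averageMap_apply {μ : Measure (Matrix.unitaryGroup (Fin d) ℂ)}
    [IsProbabilityMeasure μ] (h : IsCompletelyPositive (averageMap μ))
    {A : Matrix (Fin d) (Fin d) ℂ} (hA : A.PosSemidef) : (averageMap μ A).PosSemidef := by
  have := h 1 (A.submatrix Prod.snd Prod.snd) (hA.submatrix _)
  exact this.submatrix fun a => (0, a)

theorem integral_conjMap_apply {μ : Measure (Matrix.unitaryGroup (Fin d) ℂ)}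
    [IsProbabilityMeasure μ] (h : IsCompletelyRandomizing (averageMap μ))
    {ρ : Matrix (Fin d) (Fin d) ℂ} (hρ : IsDensity ρ) (a b : Fin d) :
    ∫ U, conjMap U ρ a b ∂μ = ((d : ℂ)⁻¹ • (1 : Matrix (Fin d) (Fin d) ℂ)) a b := by
  have h0 := eq_zero_of_traceNorm_le_zero
    ((posSemidef_averageMap_apply h.1.1 hρ.1).1.sub (isHermitian_maximallyMixed d)) (h.2 ρ hρ)
  exact congrFun (congrFun (sub_eq_zero.1 h0) a) b

theorem memLp_conjMap_apply (μ : Measure (Matrix.unitaryGroup (Fin d) ℂ)) [IsProbabilityMeasure μ]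
    (ρ : Matrix (Fin d) (Fin d) ℂ) (a b : Fin d) : MemLp (fun U => conjMap U ρ a b) 2 μ :=
  MemLp.of_bound (continuous_conjMap_entry ρ a b).measurable.aestronglyMeasurable
    _ (.of_forall fun U => norm_conjMap_entry_le U ρ a b)

theorem memLp_mixtureMap_sub_apply (μ : Fin m → Measure (Matrix.unitaryGroup (Fin d) ℂ))
    [∀ i, IsProbabilityMeasure (μ i)] (ρ A : Matrix (Fin d) (Fin d) ℂ) (a b : Fin d) :
    MemLp (fun U => (mixtureMap U ρ - A) a b) 2 (Measure.pi μ) := by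
  simp only [Matrix.sub_apply, mixtureMap_apply_apply]
  have h : ∀ i, MemLp (fun U : Fin m → Matrix.unitaryGroup (Fin d) ℂ => conjMap (U i) ρ a b) 2
      (Measure.pi μ) := fun i =>
    (memLp_conjMap_apply (μ i) ρ a b).comp_measurePreserving (measurePreserving_eval μ i)
  have h' : MemLp (fun U : Fin m → Matrix.unitaryGroup (Fin d) ℂ =>
      (m : ℂ)⁻¹ * ∑ i, conjMap (U i) ρ a b) 2 (Measure.pi μ) :=
    (memLp_finsetSum _ fun i _ => h i).const_mul _
  exact h'.sub (memLp_const _)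

theorem memLp_deviation (hd : 0 < d) (hm : 0 < m)
    (μ : Fin m → Measure (Matrix.unitaryGroup (Fin d) ℂ)) [∀ i, IsProbabilityMeasure (μ i)]
    {ρ : Matrix (Fin d) (Fin d) ℂ} (hρ : IsDensity ρ) :
    MemLp (fun U : Fin m → Matrix.unitaryGroup (Fin d) ℂ => deviation U ρ) 2 (Measure.pi μ) :=
  MemLp.of_bound (measurable_deviation hρ.1).aestronglyMeasurable 2
    (.of_forall fun U => by
      rw [Real.norm_eq_abs, abs_of_nonneg (deviation_nonneg U hρ.1)]
      exact deviation_le_two hd hm U hρ)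

theorem sum_integral_norm_sq_conjMap_pure (μ : Measure (Matrix.unitaryGroup (Fin d) ℂ))
    [IsProbabilityMeasure μ] {x : EuclideanSpace ℂ (Fin d)} (hx : ‖x‖ = 1) :
    ∑ a, ∑ b, ∫ U, ‖conjMap U (pure x) a b‖ ^ 2 ∂μ = 1 := by
  have hI : ∀ a b, Integrable (fun U => ‖conjMap U (pure x) a b‖ ^ 2) μ :=
    fun a b => (memLp_conjMap_apply μ _ a b).norm.integrable_sq
  have h1 : ∀ a, ∑ b, ∫ U, ‖conjMap U (pure x) a b‖ ^ 2 ∂μ =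
      ∫ U, ∑ b, ‖conjMap U (pure x) a b‖ ^ 2 ∂μ := fun a =>
    (integral_finsetSum _ fun b _ => hI a b).symm
  rw [Finset.sum_congr rfl fun a _ => h1 a,
    ← integral_finsetSum _ fun a _ => integrable_finsetSum _ fun b _ => hI a b]
  simp_rw [sum_norm_sq_conjMap_pure _ hx]
  simp

theorem sum_integral_norm_sq_mixtureMap_sub_le (hm : 0 < m)
    (μ : Fin m → Measure (Matrix.unitaryGroup (Fin d) ℂ))
    [∀ i, IsProbabilityMeasure (μ i)] (hμ : ∀ i, IsCompletelyRandomizing (averageMap (μ i)))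
    {x : EuclideanSpace ℂ (Fin d)} (hx : ‖x‖ = 1) :
    ∑ a, ∑ b, ∫ U, ‖(mixtureMap U (pure x) -
      (d : ℂ)⁻¹ • (1 : Matrix (Fin d) (Fin d) ℂ)) a b‖ ^ 2 ∂Measure.pi μ ≤ (m : ℝ)⁻¹ := by
  have hm' : (m : ℝ) ≠ 0 := by exact_mod_cast hm.ne'
  have h1 : ∀ a b, ∫ U, ‖(mixtureMap U (pure x) -
      (d : ℂ)⁻¹ • (1 : Matrix (Fin d) (Fin d) ℂ)) a b‖ ^ 2 ∂Measure.pi μ ≤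
      (m : ℝ)⁻¹ ^ 2 * ∑ i, ∫ U, ‖conjMap U (pure x) a b‖ ^ 2 ∂μ i := by
    intro a b
    have h := integral_norm_sq_average_sub_le hm μ (X := fun _ U => conjMap U (pure x) a b)
      (c := ((d : ℂ)⁻¹ • (1 : Matrix (Fin d) (Fin d) ℂ)) a b)
      (fun i => memLp_conjMap_apply (μ i) _ a b)
      fun i => integral_conjMap_apply (hμ i) (isDensity_pure hx) a b
    simp only [← mixtureMap_apply_apply, ← Matrix.sub_apply] at h
    exact h
  have h2 : ∑ i, ∑ a, ∑ b, ∫ U, ‖conjMap U (pure x) a b‖ ^ 2 ∂μ i = m := by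
    rw [Finset.sum_congr rfl fun i _ => sum_integral_norm_sq_conjMap_pure (μ i) hx]
    simp
  calc _ ≤ ∑ a, ∑ b, (m : ℝ)⁻¹ ^ 2 * ∑ i, ∫ U, ‖conjMap U (pure x) a b‖ ^ 2 ∂μ i :=
        Finset.sum_le_sum fun a _ => Finset.sum_le_sum fun b _ => h1 a b
    _ = (m : ℝ)⁻¹ ^ 2 * ∑ i, ∑ a, ∑ b, ∫ U, ‖conjMap U (pure x) a b‖ ^ 2 ∂μ i := by
        simp only [← Finset.mul_sum]
        exact congrArg _ ((Finset.sum_congr rfl fun a _ => Finset.sum_comm).trans Finset.sum_comm)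
    _ = (m : ℝ)⁻¹ := by rw [h2]; field_simp

theorem integral_deviation_sq_le (hd : 0 < d) (hm : 0 < m)
    (μ : Fin m → Measure (Matrix.unitaryGroup (Fin d) ℂ))
    [∀ i, IsProbabilityMeasure (μ i)] (hμ : ∀ i, IsCompletelyRandomizing (averageMap (μ i)))
    {x : EuclideanSpace ℂ (Fin d)} (hx : ‖x‖ = 1) :
    ∫ U, deviation U (pure x) ^ 2 ∂Measure.pi μ ≤ d / m := by
  let Z : Fin d → Fin d → (Fin m → Matrix.unitaryGroup (Fin d) ℂ) → ℝ := fun a b U =>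
    ‖(mixtureMap U (pure x) - (d : ℂ)⁻¹ • (1 : Matrix (Fin d) (Fin d) ℂ)) a b‖ ^ 2
  have hZ : ∀ a b, Integrable (Z a b) (Measure.pi μ) := fun a b =>
    (memLp_mixtureMap_sub_apply μ _ _ a b).norm.integrable_sq
  have hZs : ∀ a, Integrable (fun U => ∑ b, Z a b U) (Measure.pi μ) := fun a =>
    integrable_finsetSum _ fun b _ => hZ a b
  have hZss : Integrable (fun U => ∑ a, ∑ b, Z a b U) (Measure.pi μ) :=
    integrable_finsetSum _ fun a _ => hZs a
  have h1 : ∫ U, ∑ a, ∑ b, Z a b U ∂Measure.pi μ = ∑ a, ∑ b, ∫ U, Z a b U ∂Measure.pi μ := by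
    rw [integral_finsetSum _ fun a _ => hZs a]
    exact Finset.sum_congr rfl fun a _ => integral_finsetSum _ fun b _ => hZ a b
  have h2 : ∑ a, ∑ b, ∫ U, Z a b U ∂Measure.pi μ ≤ (m : ℝ)⁻¹ :=
    sum_integral_norm_sq_mixtureMap_sub_le hm μ hμ hx
  have h3 : ∀ U : Fin m → Matrix.unitaryGroup (Fin d) ℂ,
      deviation U (pure x) ^ 2 ≤ d * ∑ a, ∑ b, Z a b U :=
    fun U => traceNorm_sq_le (isHermitian_mixtureMap_sub U (posSemidef_pure x))
  have h4 := integral_mono (memLp_deviation hd hm μ (isDensity_pure hx)).integrable_sq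
    (hZss.const_mul (d : ℝ)) h3
  rw [integral_const_mul, h1] at h4
  refine h4.trans ?_
  rw [div_eq_mul_inv]
  gcongr

theorem integral_deviation_le (hd : 0 < d) (hm : 0 < m)
    (μ : Fin m → Measure (Matrix.unitaryGroup (Fin d) ℂ))
    [∀ i, IsProbabilityMeasure (μ i)] (hμ : ∀ i, IsCompletelyRandomizing (averageMap (μ i)))
    {x : EuclideanSpace ℂ (Fin d)} (hx : ‖x‖ = 1) :
    ∫ U, deviation U (pure x) ∂Measure.pi μ ≤ √(d / m) := by
  refine Real.le_sqrt_of_sq_le (le_trans ?_ (integral_deviation_sq_le hd hm μ hμ hx))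
  have h := ProbabilityTheory.variance_nonneg
    (fun U : Fin m → Matrix.unitaryGroup (Fin d) ℂ => deviation U (pure x)) (Measure.pi μ)
  rw [ProbabilityTheory.variance_eq_sub (memLp_deviation hd hm μ (isDensity_pure hx))] at h
  simp only [Pi.pow_apply] at h
  linarith

end QuantumRandomization

namespace QuantumRandomization

variable {d m : ℕ}

/-- Every density operator is a convex combination of pure states. -/
theorem exists_eq_sum_smul_pure {ρ : Matrix (Fin d) (Fin d) ℂ} (hρ : IsDensity ρ) :
    ∃ (w : Fin d → ℝ) (x : Fin d → EuclideanSpace ℂ (Fin d)), (∀ i, 0 ≤ w i) ∧ ∑ i, w i = 1 ∧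
      (∀ i, ‖x i‖ = 1) ∧ ρ = ∑ i, (w i : ℂ) • pure (x i) := by
  have hH := hρ.1.1
  refine ⟨hH.eigenvalues, hH.eigenvectorBasis, hρ.1.eigenvalues_nonneg, ?_,
    hH.eigenvectorBasis.norm_eq_one, ?_⟩
  · have h := hH.trace_eq_sum_eigenvalues
    rw [hρ.2] at h
    exact Complex.ofReal_injective (by simpa using h.symm)
  · conv_lhs => rw [hH.spectral_theorem, Unitary.conjStarAlgAut_apply]
    ext a b
    rw [Matrix.mul_apply, Matrix.sum_apply]
    refine Finset.sum_congr rfl fun i _ => ?_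
    rw [Matrix.mul_diagonal, Matrix.star_apply, Matrix.smul_apply, pure_apply,
      hH.eigenvectorUnitary_apply, hH.eigenvectorUnitary_apply]
    simp only [Function.comp_apply, Complex.coe_algebraMap, smul_eq_mul]
    ring

theorem traceNorm_sum_smul_le {ι : Type*} (s : Finset ι) {w : ι → ℝ} (hw : ∀ i, 0 ≤ w i)
    {A : ι → Matrix (Fin d) (Fin d) ℂ} (hA : ∀ i, (A i).IsHermitian) :
    (∑ i ∈ s, (w i : ℂ) • A i).IsHermitian ∧
      traceNorm (∑ i ∈ s, (w i : ℂ) • A i) ≤ ∑ i ∈ s, w i * traceNorm (A i) := by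
  have hs : ∀ i, ((w i : ℂ) • A i).IsHermitian := fun i =>
    (hA i).smul (Complex.conj_ofReal (w i))
  classical
  induction s using Finset.induction_on with
  | empty => simp [traceNorm_eq_sum_abs_eigenvalues Matrix.isHermitian_zero,
      Matrix.isHermitian_zero.eigenvalues_eq_zero_iff.2 rfl]
  | insert i s hi ih =>
    rw [Finset.sum_insert hi, Finset.sum_insert hi]
    refine ⟨(hs i).add ih.1, (traceNorm_add_le (hs i) ih.1).trans ?_⟩
    exact add_le_add (traceNorm_smul_le (hA i) (hw i)) ih.2

theorem deviation_le_of_forall_pure (U : Fin m → Matrix.unitaryGroup (Fin d) ℂ) {ε : ℝ}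
    (h : ∀ x : EuclideanSpace ℂ (Fin d), ‖x‖ = 1 → deviation U (pure x) ≤ ε)
    {ρ : Matrix (Fin d) (Fin d) ℂ} (hρ : IsDensity ρ) : deviation U ρ ≤ ε := by
  obtain ⟨w, x, hw, hw1, hx, rfl⟩ := exists_eq_sum_smul_pure hρ
  have e : mixtureMap U (∑ i, (w i : ℂ) • pure (x i)) - (d : ℂ)⁻¹ • 1 =
      ∑ i, (w i : ℂ) • (mixtureMap U (pure (x i)) - (d : ℂ)⁻¹ • 1) := by
    have hw1' : ∑ i, (w i : ℂ) = 1 := by exact_mod_cast hw1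
    simp only [smul_sub, Finset.sum_sub_distrib, map_sum, map_smul]
    rw [← Finset.sum_smul, hw1', one_smul]
  rw [deviation, e]
  refine (traceNorm_sum_smul_le _ hw fun i =>
    isHermitian_mixtureMap_sub U (posSemidef_pure (x i))).2.trans ?_
  calc _ ≤ ∑ i, w i * ε := by
        gcongr with i
        · exact hw i
        · exact h (x i) (hx i)
    _ = ε := by rw [← Finset.sum_mul, hw1, one_mul]

theorem measure_deviation_pure_ge_le (hd : 0 < d) (hm : 0 < m)
    (μ : Fin m → Measure (Matrix.unitaryGroup (Fin d) ℂ))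
    [∀ i, IsProbabilityMeasure (μ i)] (hμ : ∀ i, IsCompletelyRandomizing (averageMap (μ i)))
    {x : EuclideanSpace ℂ (Fin d)} (hx : ‖x‖ = 1) {t : ℝ} (ht : 0 ≤ t) :
    (Measure.pi μ).real {U | √(d / m) + t ≤ deviation U (pure x)} ≤
      Real.exp (-(m * t ^ 2 / 2)) := by
  have hm' : (0 : ℝ) < m := by exact_mod_cast hm
  refine (measureReal_mono fun U hU => ?_).trans ((measure_ge_le_of_bounded_differences
    (c := 2 / m) (by positivity) hm μ (fun U => deviation U (pure x))
    (measurable_deviation (posSemidef_pure x)) (B := 2) (fun U => ?_)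
    (fun U i V => abs_deviation_sub_update_le (isDensity_pure hx) U i V) ht).trans (le_of_eq ?_))
  · exact (add_le_add_left (integral_deviation_le hd hm μ hμ hx) t).trans hU
  · rw [abs_of_nonneg (deviation_nonneg U (posSemidef_pure x))]
    exact deviation_le_two hd hm U (isDensity_pure hx)
  · congr 2
    field_simp

end QuantumRandomization

open QuantumRandomization in
theorem mainTheorem2 (d : ℕ) (hd : 1 ≤ d) (ε : ℝ) (hε : 0 < ε) (hε2 : ε ≤ 2)
    (m : ℕ) (hm : 37 * (d : ℝ) / ε ^ 2 * Real.log (15 / ε) ≤ (m : ℝ))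
    (μ : Fin m → MeasureTheory.Measure (Matrix.unitaryGroup (Fin d) ℂ))
    [∀ i, MeasureTheory.IsProbabilityMeasure (μ i)]
    (hμ : ∀ i, QuantumRandomization.IsCompletelyRandomizing
      (QuantumRandomization.averageMap (μ i))) :
    1 - Real.exp (-(d : ℝ) / 2) ≤
      (MeasureTheory.Measure.pi μ).real
        {U : Fin m → Matrix.unitaryGroup (Fin d) ℂ |
          QuantumRandomization.IsRandomizing QuantumRandomization.traceNorm ε
            (QuantumRandomization.mixtureMap U)} := by
  have hd' : (1 : ℝ) ≤ d := by exact_mod_cast hd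
  set L := Real.log (15 / ε) with hL
  have hL2 : 2 ≤ L := by
    rw [hL, Real.le_log_iff_exp_le (by positivity)]
    have h1 : Real.exp 2 ≤ 7.5 := by
      have := Real.exp_one_lt_d9
      rw [show (2 : ℝ) = 1 + 1 by norm_num, Real.exp_add]
      nlinarith [Real.exp_pos 1]
    have h2 : (7.5 : ℝ) ≤ 15 / ε := by rw [le_div_iff₀ hε]; linarith
    linarith
  have hmε : 37 * d * L ≤ m * ε ^ 2 := by
    rw [div_mul_eq_mul_div, div_le_iff₀ (by positivity)] at hm
    exact hm
  have hm0 : 0 < m := by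
    rcases Nat.eq_zero_or_pos m with rfl | h
    · exfalso
      have : 0 < 37 * (d : ℝ) * L := by positivity
      simp at hmε
      linarith
    · exact h
  have hm' : (0 : ℝ) < m := by exact_mod_cast hm0
  have hsqrt : √(d / m) ≤ ε / 8 := by
    rw [Real.sqrt_le_left (by positivity), div_le_iff₀ hm']
    nlinarith
  obtain ⟨s, hs1, hs2, hs3⟩ := exists_net_unit_sphere (EuclideanSpace ℂ (Fin d))
    (η := ε / 6) (by positivity)
  have hrank : Module.finrank ℝ (EuclideanSpace ℂ (Fin d)) = 2 * d := by
    rw [finrank_real_of_complex, finrank_euclideanSpace_fin]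
  have hcard : (s.card : ℝ) ≤ Real.exp (2 * d * L) := by
    refine hs3.trans ?_
    rw [hrank, show 2 * (d : ℝ) * L = ((2 * d : ℕ) : ℝ) * L by push_cast; ring, Real.exp_nat_mul,
      hL, Real.exp_log (by positivity)]
    gcongr
    rw [le_div_iff₀ hε]
    field_simp
    linarith
  set bad : EuclideanSpace ℂ (Fin d) → Set (Fin m → Matrix.unitaryGroup (Fin d) ℂ) := fun c =>
    {U | √(d / m) + 13 / 24 * ε ≤ deviation U (pure c)} with hbad
  set good : Set (Fin m → Matrix.unitaryGroup (Fin d) ℂ) :=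
    {U | IsRandomizing traceNorm ε (mixtureMap U)} with hgood
  have hcover : Set.univ ⊆ good ∪ ⋃ c ∈ s, bad c := by
    intro U _
    by_cases h : ∃ c ∈ s, U ∈ bad c
    · obtain ⟨c, hc, hU⟩ := h
      exact Or.inr (Set.mem_biUnion hc hU)
    · left
      push Not at h
      refine ⟨isCPTP_mixtureMap hm0 U, fun ρ hρ =>
        deviation_le_of_forall_pure U (fun x hx => ?_) hρ⟩
      obtain ⟨c, hc, hxc⟩ := hs2 x hx
      have h1 := deviation_pure_le hm0 U hx (hs1 c hc)
      have h2 : deviation U (pure c) < √(d / m) + 13 / 24 * ε := not_le.1 (h c hc)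
      linarith
  have hbadle : ∀ c ∈ s, (Measure.pi μ).real (bad c) ≤ Real.exp (-(2 * d * L) - d / 2) := by
    intro c hc
    refine (measure_deviation_pure_ge_le hd hm0 μ hμ (hs1 c hc) (by positivity)).trans ?_
    refine Real.exp_le_exp.2 ?_
    nlinarith
  have hsum : (Measure.pi μ).real (⋃ c ∈ s, bad c) ≤ Real.exp (-(d : ℝ) / 2) := by
    refine (measureReal_biUnion_finset_le s bad).trans ((Finset.sum_le_sum hbadle).trans ?_)
    rw [Finset.sum_const, nsmul_eq_mul]
    calc _ ≤ Real.exp (2 * d * L) * Real.exp (-(2 * d * L) - d / 2) := by gcongr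
      _ = _ := by rw [← Real.exp_add]; congr 1; ring
  have htot := (measureReal_mono (μ := Measure.pi μ) hcover).trans (measureReal_union_le _ _)
  rw [probReal_univ] at htot
  linarith
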